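/- Call a finite simple graph $H$ a bipartite chain graph if its vertex set is the disjoint union of two independent sets $X=\{x_1,\dots,x_{n_1}\}$ and $Y=\{y_1,\dots,y_{n_2}\}$ that can be ordered so that $N(x_{n_1})\subseteq\dots\subseteq N(x_1)$ and $N(y_{n_2})\subseteq\dots\subseteq N(y_1)$. For a finite simple graph $G$, a transitive $k$-partition is a partition $\{V_1,\dots,V_k\}$ of $V(G)$ into $k$ nonempty parts such that for all $1\le i<j\le k$ every vertex of $V_j$ is adjacent in $G$ to some vertex of $V_i$; the transitivity $Tr(G)$ is the maximum $k$ for which such a partition exists. Theorem. The transitivity of complements of bipartite chain graphs can be computed in linear time. Precisely: there are one program for the unit-cost random access machine (with comparison, addition, truncated subtraction and indirect addressing) and one constant $c$ such that, for every graph $G$ on the vertex set $\{0,\dots,n-1\}$ with $m$ edges whose complement is a bipartite chain graph, and for every adjacency-list representation of $G$ given as input (with the neighbours of each vertex listed in any order), the program halts after at most $c\,(n+m+1)$ steps with output $Tr(G)$. Moreover, all numbers written during the computation are at most $c\,(n+m+1)$, that is, they fit into machine words of $O(\log(n+m+2))$ bits. -/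

import Mathlib

/-! ### Transitivity of a graph -/

/-- `A` dominates `B` in `G`: every vertex of `B` is adjacent to at least one vertex of `A`. -/
def SetDominates {V : Type*} (G : SimpleGraph V) (A B : Set V) : Prop :=
  ∀ b ∈ B, ∃ a ∈ A, G.Adj a b

/-- `P 0, …, P (k - 1)` is a transitive `k`-partition of `G`: a partition of the vertex set into `k`
nonempty parts such that each part dominates all later ones. -/
structure IsTransitivePartition {V : Type*} (G : SimpleGraph V) (k : ℕ) (P : Fin k → Set V) :
    Prop where
  nonempty : ∀ i, (P i).Nonempty
  disjoint : ∀ i j, i ≠ j → Disjoint (P i) (P j)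
  cover : ⋃ i, P i = Set.univ
  dominates : ∀ i j, i < j → SetDominates G (P i) (P j)

/-- The transitivity `Tr(G)`: the maximum `k` for which a transitive `k`-partition exists. -/
noncomputable def transitivity {V : Type*} (G : SimpleGraph V) : ℕ :=
  sSup {k : ℕ | ∃ P : Fin k → Set V, IsTransitivePartition G k P}

/-- On a finite graph the supremum in the definition of `transitivity` is a maximum. -/
theorem isGreatest_transitivity {V : Type*} [Finite V] (G : SimpleGraph V) :
    IsGreatest {k : ℕ | ∃ P : Fin k → Set V, IsTransitivePartition G k P} (transitivity G) := by
  have hbdd : BddAbove {k : ℕ | ∃ P : Fin k → Set V, IsTransitivePartition G k P} := by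
    refine ⟨Nat.card V, ?_⟩
    rintro k ⟨P, hP⟩
    choose f hf using hP.nonempty
    have hinj : Function.Injective f := by
      intro i j hij
      by_contra hne
      exact Set.disjoint_left.mp (hP.disjoint i j hne) (hf i) (hij ▸ hf j)
    simpa using Nat.card_le_card_of_injective f hinj
  have hne : {k : ℕ | ∃ P : Fin k → Set V, IsTransitivePartition G k P}.Nonempty := by
    rcases isEmpty_or_nonempty V with hV | hV
    · exact ⟨0, fun i => i.elim0, fun i => i.elim0, fun i => i.elim0,
        Set.eq_univ_of_forall fun v => hV.elim v, fun i => i.elim0⟩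
    · refine ⟨1, fun _ => Set.univ, fun _ => Set.univ_nonempty, ?_, ?_, ?_⟩
      · intro i j hij
        exact absurd (Subsingleton.elim i j) hij
      · exact Set.iUnion_const _
      · intro i j hij
        exact absurd (Subsingleton.elim i j) hij.ne
  exact ⟨Nat.sSup_mem hne hbdd, fun k hk => le_csSup hbdd hk⟩

/-! ### Bipartite chain graphs -/

/-- `H` is a bipartite chain graph: its vertex set is the disjoint union of two independent sets
`X = {x 0, …, x (n₁ - 1)}` and `Y = {y 0, …, y (n₂ - 1)}`, listed without repetition, such that
`N(x (n₁ - 1)) ⊆ ⋯ ⊆ N(x 0)` and `N(y (n₂ - 1)) ⊆ ⋯ ⊆ N(y 0)`. -/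
def IsBipartiteChain {V : Type*} (H : SimpleGraph V) : Prop :=
  ∃ (n₁ n₂ : ℕ) (x : Fin n₁ → V) (y : Fin n₂ → V),
    Function.Injective x ∧ Function.Injective y ∧
    Disjoint (Set.range x) (Set.range y) ∧ Set.range x ∪ Set.range y = Set.univ ∧
    H.IsIndepSet (Set.range x) ∧ H.IsIndepSet (Set.range y) ∧
    (∀ i j, i ≤ j → H.neighborSet (x j) ⊆ H.neighborSet (x i)) ∧
    (∀ i j, i ≤ j → H.neighborSet (y j) ⊆ H.neighborSet (y i))

/-! ### Random access machines

Programs of a unit-cost random access machine, written with structured control flow. A program is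
a finite object that mentions finitely many registers; the memory is addressed indirectly. There is
no multiplication, and every number that is written has to fit into a machine word, that is, it has
to be at most a bound `B` that is a parameter of the execution. -/

namespace RAM

/-- An operand is a constant or the content of a register. -/
inductive Operand : Type
  | imm (k : ℕ)
  | reg (r : ℕ)

/-- Elementary instructions. Here `r` is the register that receives the result. -/
inductive Instr : Type
  | mov (r : ℕ) (a : Operand)
  | add (r : ℕ) (a b : Operand)
  | sub (r : ℕ) (a b : Operand)
  | load (r : ℕ) (addr : Operand)
  | store (addr a : Operand)

/-- Programs. The branch `ite a b p q` executes `p` if `a < b` and `q` otherwise, and the loop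
`loop a b p` executes `p` as long as `a < b`. -/
inductive Prog : Type
  | skip
  | instr (i : Instr)
  | seq (p q : Prog)
  | ite (a b : Operand) (p q : Prog)
  | loop (a b : Operand) (p : Prog)

/-- A state: the contents of the registers and of the memory cells. -/
structure State : Type where
  reg : ℕ → ℕ
  mem : ℕ → ℕ

/-- The value of an operand. -/
def Operand.val (s : State) : Operand → ℕ
  | .imm k => k
  | .reg r => s.reg r

/-- The number that an instruction writes; `sub` is truncated subtraction. -/
def Instr.result (s : State) : Instr → ℕ
  | .mov _ a => a.val s
  | .add _ a b => a.val s + b.val s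
  | .sub _ a b => a.val s - b.val s
  | .load _ addr => s.mem (addr.val s)
  | .store _ a => a.val s

/-- The state after an instruction. -/
def Instr.next (s : State) : Instr → State
  | .store addr a => { s with mem := Function.update s.mem (addr.val s) (a.val s) }
  | .mov r a => { s with reg := Function.update s.reg r (Instr.result s (.mov r a)) }
  | .add r a b => { s with reg := Function.update s.reg r (Instr.result s (.add r a b)) }
  | .sub r a b => { s with reg := Function.update s.reg r (Instr.result s (.sub r a b)) }
  | .load r addr => { s with reg := Function.update s.reg r (Instr.result s (.load r addr)) }

/-- `Exec B p s t s'`: started in state `s`, the program `p` halts in state `s'` after exactly `t`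
steps, and every number written on the way is at most `B`. Each elementary instruction and each
evaluation of a condition is one step. The rules are deterministic. -/
inductive Exec (B : ℕ) : Prog → State → ℕ → State → Prop
  | skip (s : State) : Exec B .skip s 1 s
  | instr (i : Instr) (s : State) (h : i.result s ≤ B) : Exec B (.instr i) s 1 (i.next s)
  | seq {p q : Prog} {s s' s'' : State} {t t' : ℕ} (hp : Exec B p s t s')
      (hq : Exec B q s' t' s'') : Exec B (.seq p q) s (t + t') s''
  | ite_true {a b : Operand} {p q : Prog} {s s' : State} {t : ℕ} (h : a.val s < b.val s)
      (hp : Exec B p s t s') : Exec B (.ite a b p q) s (t + 1) s'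
  | ite_false {a b : Operand} {p q : Prog} {s s' : State} {t : ℕ} (h : ¬ a.val s < b.val s)
      (hq : Exec B q s t s') : Exec B (.ite a b p q) s (t + 1) s'
  | loop_true {a b : Operand} {p : Prog} {s s' s'' : State} {t t' : ℕ} (h : a.val s < b.val s)
      (hp : Exec B p s t s') (hl : Exec B (.loop a b p) s' t' s'') :
      Exec B (.loop a b p) s (t + t' + 1) s''
  | loop_false {a b : Operand} {p : Prog} {s : State} (h : ¬ a.val s < b.val s) :
      Exec B (.loop a b p) s 1 s

/-- The initial state on input `w`: the input is written to the memory from cell `0` on, and all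
other cells and all registers are `0`. -/
def initState (w : List ℕ) : State where
  reg := fun _ => 0
  mem := fun i => w.getD i 0

end RAM

/-! ### Graphs as inputs -/

/-- `adj` is an adjacency-list representation of `G`: `adj v` lists the neighbours of `v` without
repetition, in any order. -/
def IsAdjacencyLists {n : ℕ} (G : SimpleGraph (Fin n)) (adj : Fin n → List (Fin n)) : Prop :=
  ∀ v, (adj v).Nodup ∧ ∀ u, u ∈ adj v ↔ G.Adj v u

/-- The input word of adjacency lists: the number `n` of vertices, followed, for each vertex
`v = 0, …, n - 1`, by the length of the list of `v` and the entries of this list. -/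
def encodeAdjacencyLists {n : ℕ} (adj : Fin n → List (Fin n)) : List ℕ :=
  n :: (List.ofFn adj).flatMap fun l => l.length :: l.map fun u => (u : ℕ)

/-! ### Balanced bicliques that meet every edge -/

section Combinatorics

variable {V : Type*}

/-! Let `H` be the complement of `G`. The chain orderings make the bipartite adjacency matrix of `H`
a staircase; its largest corner square, of side `t`, is a biclique meeting every edge of `H`, and
`Tr(G) = n - t`.

Lower bound (`exists_isTransitivePartition`): as `H` is triangle-free, each pair `{x i, y i}`
dominates all other vertices in `G`; the vertices off the biclique are independent in `H`, hence a
clique of `G`, and serve as singletons. Upper bound (`add_le_of_anticomplete`): `G` has no edges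
between the two sides of the biclique, so one side contains no part, and every part has a vertex
among the other `n - t`.

Biclique vertices have `H`-degree at least `t`, all others at most `t`. So fewer than `2 * s`
vertices have `H`-degree at least `s` exactly when `t < s`, and the number of such `s` in `1, …, n`
is `n - t`. Counting them naively takes quadratic time, which is linear in the input because `G` is
covered by two cliques and has order `n²` edges. -/

/-- Two families of `t` vertices each that span a complete bipartite subgraph of `H`
and together meet every edge of `H`. -/
structure IsCoveringBiclique (H : SimpleGraph V) {t : ℕ} (x y : Fin t → V) : Prop where
  injective_left : Function.Injective x
  injective_right : Function.Injective y
  adj : ∀ i j, H.Adj (x i) (y j)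
  covers : ∀ u v, H.Adj u v →
    u ∈ Set.range x ∪ Set.range y ∨ v ∈ Set.range x ∪ Set.range y

/-- Two of three vertices share an independent side. The results on covering bicliques use
bipartiteness only in this form. -/
theorem IsBipartiteChain.not_triangle {H : SimpleGraph V} (hH : IsBipartiteChain H) {a b c : V}
    (hab : H.Adj a b) (hac : H.Adj a c) (hbc : H.Adj b c) : False := by
  obtain ⟨n₁, n₂, x, y, -, -, -, hcov, hX, hY, -, -⟩ := hH
  have key : ∀ v, v ∈ Set.range x ∨ v ∈ Set.range y := fun v => by
    have : v ∈ Set.range x ∪ Set.range y := hcov ▸ Set.mem_univ v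
    exact this
  have hX' : ∀ {u v}, u ∈ Set.range x → v ∈ Set.range x → ¬ H.Adj u v :=
    fun hu hv h => hX hu hv h.ne h
  have hY' : ∀ {u v}, u ∈ Set.range y → v ∈ Set.range y → ¬ H.Adj u v :=
    fun hu hv h => hY hu hv h.ne h
  rcases key a with ha | ha <;> rcases key b with hb | hb <;> rcases key c with hc | hc
  all_goals first
    | exact hX' ha hb hab
    | exact hX' ha hc hac
    | exact hX' hb hc hbc
    | exact hY' ha hb hab
    | exact hY' ha hc hac
    | exact hY' hb hc hbc

theorem IsBipartiteChain.exists_isCoveringBiclique {H : SimpleGraph V} (hH : IsBipartiteChain H) :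
    ∃ (t : ℕ) (x y : Fin t → V), IsCoveringBiclique H x y := by
  classical
  obtain ⟨n₁, n₂, x, y, hx, hy, -, hcov, hX, hY, hNx, hNy⟩ := hH
  let Q : ℕ → Prop := fun t => ∀ (i : Fin n₁) (j : Fin n₂), i < t → j < t → H.Adj (x i) (y j)
  have hQ0 : Q 0 := fun i j hi => absurd hi (Nat.not_lt_zero _)
  obtain ⟨t, ht, hQt, hmax⟩ : ∃ t, t ≤ min n₁ n₂ ∧ Q t ∧ (t < min n₁ n₂ → ¬ Q (t + 1)) := by
    refine ⟨Nat.findGreatest Q (min n₁ n₂), Nat.findGreatest_le _,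
      Nat.findGreatest_spec (Nat.zero_le _) hQ0, fun hlt => ?_⟩
    exact Nat.findGreatest_is_greatest (Nat.lt_succ_self _) hlt
  have h₁ : t ≤ n₁ := ht.trans (min_le_left _ _)
  have h₂ : t ≤ n₂ := ht.trans (min_le_right _ _)
  have corner : ∀ (i : Fin n₁) (j : Fin n₂), H.Adj (x i) (y j) → (i : ℕ) < t ∨ (j : ℕ) < t := by
    intro i j hij
    by_contra! hcon
    obtain ⟨hi, hj⟩ := hcon
    -- An edge with both indices at least `t` would, by nestedness in each coordinate, fill the
    -- square of side `t + 1`.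
    refine hmax (lt_min (hi.trans_lt i.2) (hj.trans_lt j.2)) fun i' j' hi' hj' => ?_
    have h1 : H.Adj (x i') (y j) := hNx i' i (Fin.le_def.2 (by omega)) hij
    exact (hNy j' j (Fin.le_def.2 (by omega)) h1.symm).symm
  refine ⟨t, x ∘ Fin.castLE h₁, y ∘ Fin.castLE h₂, hx.comp (Fin.castLE_injective _),
    hy.comp (Fin.castLE_injective _), fun i j => hQt _ _ i.2 j.2, ?_⟩
  have memX : ∀ i : Fin n₁, (i : ℕ) < t → x i ∈ Set.range (x ∘ Fin.castLE h₁) :=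
    fun i hi => ⟨⟨i, hi⟩, rfl⟩
  have memY : ∀ i : Fin n₂, (i : ℕ) < t → y i ∈ Set.range (y ∘ Fin.castLE h₂) :=
    fun i hi => ⟨⟨i, hi⟩, rfl⟩
  intro u v huv
  have hu : u ∈ Set.range x ∪ Set.range y := hcov ▸ Set.mem_univ u
  have hv : v ∈ Set.range x ∪ Set.range y := hcov ▸ Set.mem_univ v
  rcases hu with hu | hu <;> rcases hv with hv | hv
  · exact absurd huv (hX hu hv huv.ne)
  · obtain ⟨i, rfl⟩ := hu
    obtain ⟨j, rfl⟩ := hv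
    exact (corner i j huv).imp (fun h => Or.inl (memX i h)) fun h => Or.inr (memY j h)
  · obtain ⟨j, rfl⟩ := hu
    obtain ⟨i, rfl⟩ := hv
    exact (corner i j huv.symm).symm.imp (fun h => Or.inr (memY j h)) fun h => Or.inl (memX i h)
  · exact absurd huv (hY hu hv huv.ne)

/-! ### Upper bounds on the number of parts. -/

/-- Choosing a vertex outside `A` from each part gives `k` distinct vertices of the complement of
`A`. -/
theorem IsTransitivePartition.add_card_le [Fintype V] {G : SimpleGraph V} {k : ℕ}
    {P : Fin k → Set V} (hP : IsTransitivePartition G k P) (A : Finset V)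
    (hA : ∀ i, ¬ P i ⊆ A) : k + A.card ≤ Fintype.card V := by
  classical
  choose f hf hfA using fun i => Set.not_subset.1 (hA i)
  have hinj : Function.Injective f := by
    intro i j hij
    by_contra hne
    exact Set.disjoint_left.mp (hP.disjoint i j hne) (hf i) (hij ▸ hf j)
  have h : (Finset.univ.image f).card ≤ Aᶜ.card := by
    refine Finset.card_le_card fun v hv => ?_
    obtain ⟨i, -, rfl⟩ := Finset.mem_image.1 hv
    simpa using hfA i
  rw [Finset.card_image_of_injective _ hinj, Finset.card_univ, Fintype.card_fin,
    Finset.card_compl] at h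
  have := A.card_le_univ
  omega

/-- Two sets without edges between them cannot both contain parts of a transitive partition. -/
theorem IsTransitivePartition.add_le_of_anticomplete [Fintype V] {G : SimpleGraph V} {k t : ℕ}
    {P : Fin k → Set V} (hP : IsTransitivePartition G k P) {A B : Finset V}
    (hA : A.card = t) (hB : B.card = t) (hdisj : Disjoint A B)
    (hAB : ∀ a ∈ A, ∀ b ∈ B, ¬ G.Adj a b) : k + t ≤ Fintype.card V := by
  by_cases hA' : ∀ i, ¬ P i ⊆ A
  · exact hA ▸ hP.add_card_le A hA'
  by_cases hB' : ∀ i, ¬ P i ⊆ B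
  · exact hB ▸ hP.add_card_le B hB'
  -- Now one part lies in `A` and another in `B`; the earlier cannot dominate the later.
  push Not at hA' hB'
  obtain ⟨i, hi⟩ := hA'
  obtain ⟨j, hj⟩ := hB'
  obtain ⟨a, ha⟩ := hP.nonempty i
  obtain ⟨b, hb⟩ := hP.nonempty j
  rcases lt_trichotomy i j with h | rfl | h
  · obtain ⟨a', ha', hadj⟩ := hP.dominates i j h b hb
    exact absurd hadj (hAB a' (hi ha') b (hj hb))
  · exact absurd (hj ha) (Finset.disjoint_left.1 hdisj (hi ha))
  · obtain ⟨b', hb', hadj⟩ := hP.dominates j i h a ha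
    exact absurd hadj.symm (hAB a (hi ha) b' (hj hb'))

/-! ### Transitivity and degrees in terms of a covering biclique. -/

namespace IsCoveringBiclique

variable {H : SimpleGraph V} {t : ℕ} {x y : Fin t → V}

theorem ne (h : IsCoveringBiclique H x y) (i j : Fin t) : x i ≠ y j := (h.adj i j).ne

section Finite

variable [DecidableEq V]

/-- The vertices of the biclique. -/
def support (x y : Fin t → V) : Finset V := Finset.univ.image x ∪ Finset.univ.image y

theorem mem_support {v : V} : v ∈ support x y ↔ v ∈ Set.range x ∪ Set.range y := by
  simp [support]

theorem card_support (h : IsCoveringBiclique H x y) : (support x y).card = 2 * t := by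
  rw [support, Finset.card_union_of_disjoint, Finset.card_image_of_injective _ h.injective_left,
    Finset.card_image_of_injective _ h.injective_right, Finset.card_univ, Fintype.card_fin,
    two_mul]
  rw [Finset.disjoint_left]
  intro v hv hv'
  obtain ⟨i, -, rfl⟩ := Finset.mem_image.1 hv
  obtain ⟨j, -, hj⟩ := Finset.mem_image.1 hv'
  exact h.ne i j hj.symm

variable [Fintype V]

theorem two_mul_le_card (h : IsCoveringBiclique H x y) : 2 * t ≤ Fintype.card V :=
  h.card_support ▸ Finset.card_le_univ _

/-- The pairs `{x i, y i}`, followed by the remaining vertices as singletons, form a transitive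
partition of the complement. -/
theorem exists_isTransitivePartition {G : SimpleGraph V} (h : IsCoveringBiclique Gᶜ x y)
    (htri : ∀ a b c, Gᶜ.Adj a b → Gᶜ.Adj a c → Gᶜ.Adj b c → False) :
    ∃ P : Fin (Fintype.card V - t) → Set V,
      IsTransitivePartition G (Fintype.card V - t) P := by
  have hcard := h.two_mul_le_card
  have hR : (support x y)ᶜ.card = Fintype.card V - 2 * t := by
    rw [Finset.card_compl, h.card_support]
  -- This form lets `Fin.addCases` list the `t` pairs before the singletons.
  have hk : Fintype.card V - t = t + (Fintype.card V - 2 * t) := by omega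
  rw [hk]
  generalize Fintype.card V - 2 * t = r at hR
  let e := (Finset.equivFinOfCardEq hR).symm
  have he : ∀ j, (e j : V) ∉ support x y := fun j => Finset.mem_compl.1 (e j).2
  have hex : ∀ j i, (e j : V) ≠ x i := fun j i hj => he j (mem_support.2 (Or.inl ⟨i, hj.symm⟩))
  have hey : ∀ j i, (e j : V) ≠ y i := fun j i hj => he j (mem_support.2 (Or.inr ⟨i, hj.symm⟩))
  -- A vertex missed by both `x i` and `y i` would form a triangle with them in `Gᶜ`.
  have hpair : ∀ (i : Fin t) (v : V), v ≠ x i → v ≠ y i → ∃ a ∈ ({x i, y i} : Set V), G.Adj a v := by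
    intro i v hvx hvy
    by_contra! hcon
    have h1 := hcon (x i) (by simp)
    have h2 := hcon (y i) (by simp)
    exact htri (x i) (y i) v (h.adj i i) ((SimpleGraph.compl_adj _ _ _).2 ⟨hvx.symm, h1⟩)
      ((SimpleGraph.compl_adj _ _ _).2 ⟨hvy.symm, h2⟩)
  refine ⟨Fin.addCases (fun i => {x i, y i}) (fun j => {(e j : V)}), ?_, ?_, ?_, ?_⟩
  · intro i
    refine Fin.addCases (fun i => ?_) (fun j => ?_) i
    · simp
    · simp
  · intro i j
    refine Fin.addCases (fun i => ?_) (fun i => ?_) i <;>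
      refine Fin.addCases (fun j => ?_) (fun j => ?_) j
    · intro hij
      have hij' : i ≠ j := fun hh => hij (hh ▸ rfl)
      simp only [Fin.addCases_left]
      rw [Set.disjoint_left]
      rintro v (rfl | rfl) (hv | hv)
      · exact hij' (h.injective_left hv)
      · exact h.ne _ _ hv
      · exact h.ne _ _ hv.symm
      · exact hij' (h.injective_right hv)
    · intro _
      simp only [Fin.addCases_left, Fin.addCases_right]
      rw [Set.disjoint_singleton_right]
      rintro (hv | hv)
      · exact hex _ _ hv
      · exact hey _ _ hv
    · intro _
      simp only [Fin.addCases_left, Fin.addCases_right]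
      rw [Set.disjoint_singleton_left]
      rintro (hv | hv)
      · exact hex _ _ hv
      · exact hey _ _ hv
    · intro hij
      simp only [Fin.addCases_right]
      rw [Set.disjoint_singleton]
      exact fun hh => hij (by rw [e.injective (Subtype.ext hh)])
  · rw [Set.eq_univ_iff_forall]
    intro v
    rw [Set.mem_iUnion]
    by_cases hv : v ∈ support x y
    · rcases mem_support.1 hv with ⟨i, rfl⟩ | ⟨i, rfl⟩
      · exact ⟨Fin.castAdd r i, by simp⟩
      · exact ⟨Fin.castAdd r i, by simp⟩
    · refine ⟨Fin.natAdd t (e.symm ⟨v, Finset.mem_compl.2 hv⟩), by simp⟩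
  · intro i j
    refine Fin.addCases (fun i => ?_) (fun i => ?_) i <;>
      refine Fin.addCases (fun j => ?_) (fun j => ?_) j
    · intro hij b hb
      have hij' : j ≠ i := fun hh => by simp [hh] at hij
      simp only [Fin.addCases_left] at hb ⊢
      rcases hb with rfl | rfl
      · exact hpair i _ (fun hh => hij' (h.injective_left hh)) (h.ne _ _)
      · exact hpair i _ (h.ne _ _).symm (fun hh => hij' (h.injective_right hh))
    · intro _ b hb
      simp only [Fin.addCases_left, Fin.addCases_right] at hb ⊢
      rcases hb with rfl
      exact hpair i _ (hex _ _) (hey _ _)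
    · intro hij
      simp only [Fin.lt_def, Fin.val_natAdd, Fin.val_castAdd] at hij
      omega
    · intro hij b hb
      simp only [Fin.addCases_right] at hb ⊢
      rcases hb with rfl
      refine ⟨e i, rfl, ?_⟩
      -- Nonadjacent leftover vertices would span an edge of `Gᶜ` that the biclique does not meet.
      by_contra hcon
      have hne : (e i : V) ≠ e j := fun hh => by
        rw [e.injective (Subtype.ext hh)] at hij
        exact lt_irrefl _ hij
      rcases h.covers _ _ ((SimpleGraph.compl_adj _ _ _).2 ⟨hne, hcon⟩) with hh | hh
      · exact he i (mem_support.2 hh)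
      · exact he j (mem_support.2 hh)

theorem transitivity_eq {G : SimpleGraph V} (h : IsCoveringBiclique Gᶜ x y)
    (htri : ∀ a b c, Gᶜ.Adj a b → Gᶜ.Adj a c → Gᶜ.Adj b c → False) :
    transitivity G = Fintype.card V - t := by
  refine le_antisymm ?_ ((isGreatest_transitivity G).2 (h.exists_isTransitivePartition htri))
  obtain ⟨P, hP⟩ := (isGreatest_transitivity G).1
  have := hP.add_le_of_anticomplete (t := t) (A := Finset.univ.image x) (B := Finset.univ.image y)
    (by simp [Finset.card_image_of_injective _ h.injective_left])
    (by simp [Finset.card_image_of_injective _ h.injective_right])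
    (by
      rw [Finset.disjoint_left]
      intro v hv hv'
      obtain ⟨i, -, rfl⟩ := Finset.mem_image.1 hv
      obtain ⟨j, -, hj⟩ := Finset.mem_image.1 hv'
      exact h.ne i j hj.symm)
    (by
      intro a ha b hb
      obtain ⟨i, -, rfl⟩ := Finset.mem_image.1 ha
      obtain ⟨j, -, rfl⟩ := Finset.mem_image.1 hb
      exact ((SimpleGraph.compl_adj _ _ _).1 (h.adj i j)).2)
  omega

variable [DecidableRel H.Adj]

theorem le_degree (h : IsCoveringBiclique H x y) {v : V} (hv : v ∈ support x y) :
    t ≤ H.degree v := by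
  have key : ∀ f : Fin t → V, Function.Injective f → (∀ i, H.Adj v (f i)) → t ≤ H.degree v := by
    intro f hf hadj
    have := Finset.card_le_card (s := Finset.univ.image f) (t := H.neighborFinset v)
      fun w hw => by
        obtain ⟨i, -, rfl⟩ := Finset.mem_image.1 hw
        exact (H.mem_neighborFinset v _).2 (hadj i)
    rwa [Finset.card_image_of_injective _ hf, Finset.card_univ, Fintype.card_fin] at this
  rcases mem_support.1 hv with ⟨i, rfl⟩ | ⟨i, rfl⟩
  · exact key y h.injective_right fun j => h.adj i j
  · exact key x h.injective_left fun j => (h.adj j i).symm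

/-- All neighbours of an outside vertex lie in the biclique, and by triangle-freeness on a single
side of it. -/
theorem degree_le (h : IsCoveringBiclique H x y)
    (htri : ∀ a b c, H.Adj a b → H.Adj a c → H.Adj b c → False) {v : V} (hv : v ∉ support x y) :
    H.degree v ≤ t := by
  have key : ∀ f : Fin t → V, (∀ w, H.Adj v w → w ∈ Set.range f) → H.degree v ≤ t := by
    intro f hf
    have : (H.neighborFinset v).card ≤ (Finset.univ.image f).card :=
      Finset.card_le_card fun w hw => by
        simpa using hf w ((H.mem_neighborFinset v _).1 hw)
    exact this.trans (Finset.card_image_le.trans (by simp))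
  have hcov : ∀ w, H.Adj v w → w ∈ Set.range x ∪ Set.range y := fun w hw =>
    (h.covers v w hw).resolve_left fun hh => hv (mem_support.2 hh)
  by_cases hx : ∃ i, H.Adj v (x i)
  · obtain ⟨i, hi⟩ := hx
    refine key x fun w hw => (hcov w hw).resolve_right ?_
    rintro ⟨j, rfl⟩
    exact htri _ _ _ hi hw (h.adj i j)
  · refine key y fun w hw => (hcov w hw).resolve_left ?_
    rintro ⟨i, rfl⟩
    exact hx ⟨i, hw⟩

/-- The size of a covering biclique is determined by the degree sequence. -/
theorem card_degree_lt_iff (h : IsCoveringBiclique H x y)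
    (htri : ∀ a b c, H.Adj a b → H.Adj a c → H.Adj b c → False) (s : ℕ) :
    (Finset.univ.filter fun v => s ≤ H.degree v).card < 2 * s ↔ t < s := by
  -- If `s ≤ t`, all `2 * t` biclique vertices are counted; if `t < s`, only biclique vertices can
  -- be.
  constructor
  · intro hlt
    by_contra! hst
    have := Finset.card_le_card (s := support x y)
      (t := Finset.univ.filter fun v => s ≤ H.degree v)
      fun v hv => Finset.mem_filter.2 ⟨Finset.mem_univ v, hst.trans (h.le_degree hv)⟩
    rw [h.card_support] at this
    omega
  · intro hts
    have := Finset.card_le_card (s := Finset.univ.filter fun v => s ≤ H.degree v)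
      (t := support x y) fun v hv => by
        by_contra hcon
        have := h.degree_le htri hcon
        have := (Finset.mem_filter.1 hv).2
        omega
    rw [h.card_support] at this
    omega

end Finite

end IsCoveringBiclique

/-- The threshold is `s + 1`, and degrees in `G` and `Gᶜ` add up to `n - 1`, so the filter selects
the interval from `t` to `n - 1`. Its size is the answer itself, so `t` need not be computed. -/
theorem transitivity_eq_card_filter {n : ℕ} (G : SimpleGraph (Fin n)) [DecidableRel G.Adj]
    (hG : IsBipartiteChain Gᶜ) :
    transitivity G = ((Finset.range n).filter fun s =>
      (Finset.univ.filter fun v => G.degree v + (s + 1) < n).card < 2 * (s + 1)).card := by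
  obtain ⟨t, x, y, h⟩ := hG.exists_isCoveringBiclique
  have htri : ∀ a b c, Gᶜ.Adj a b → Gᶜ.Adj a c → Gᶜ.Adj b c → False :=
    fun _ _ _ hab hac hbc => hG.not_triangle hab hac hbc
  have hdeg : ∀ (v : Fin n) (s : ℕ), G.degree v + (s + 1) < n ↔ s + 1 ≤ Gᶜ.degree v := by
    intro v s
    have h1 := G.degree_compl v
    have h2 := G.degree_lt_card_verts v
    rw [Fintype.card_fin] at h1 h2
    omega
  have hfilter : ((Finset.range n).filter fun s =>
      (Finset.univ.filter fun v => G.degree v + (s + 1) < n).card < 2 * (s + 1)) =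
      Finset.Ico t n := by
    ext s
    simp only [hdeg, Finset.mem_filter, Finset.mem_range, Finset.mem_Ico,
      h.card_degree_lt_iff htri]
    omega
  rw [hfilter, Nat.card_Ico, h.transitivity_eq htri, Fintype.card_fin]

/-! ### Density of the input graph. -/

/-- A graph whose complement is a bipartite chain graph is dense. -/
theorem sq_le_of_isBipartiteChain_compl {n : ℕ} (G : SimpleGraph (Fin n)) [DecidableRel G.Adj]
    (hG : IsBipartiteChain Gᶜ) : n * n ≤ 2 * (n + ∑ v, G.degree v) := by
  obtain ⟨n₁, n₂, x, y, hx, hy, hdisj, hcov, hX, hY, -, -⟩ := hG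
  -- An independent side of `Gᶜ` is a clique of `G`.
  have hclique : ∀ {k : ℕ} (f : Fin k → Fin n), Function.Injective f →
      Gᶜ.IsIndepSet (Set.range f) → ∀ i, k ≤ G.degree (f i) + 1 := by
    intro k f hf hind i
    rw [← G.card_neighborFinset_eq_degree]
    refine le_trans ?_ (Finset.card_insert_le (f i) _)
    have := Finset.card_le_card (s := Finset.univ.image f)
      (t := insert (f i) (G.neighborFinset (f i))) fun w hw => by
        obtain ⟨j, -, rfl⟩ := Finset.mem_image.1 hw
        by_cases hij : f i = f j
        · simp [hij]
        · refine Finset.mem_insert_of_mem ((G.mem_neighborFinset _ _).2 ?_)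
          by_contra hcon
          exact hind ⟨i, rfl⟩ ⟨j, rfl⟩ hij ((SimpleGraph.compl_adj _ _ _).2 ⟨hij, hcon⟩)
    rwa [Finset.card_image_of_injective _ hf, Finset.card_univ, Fintype.card_fin] at this
  have hbij : Function.Bijective (Sum.elim x y) := by
    constructor
    · rintro (i | i) (j | j) hij
      · exact congrArg Sum.inl (hx hij)
      · exact (Set.disjoint_left.1 hdisj ⟨i, rfl⟩ ⟨j, hij.symm⟩).elim
      · exact (Set.disjoint_left.1 hdisj ⟨j, rfl⟩ ⟨i, hij⟩).elim
      · exact congrArg Sum.inr (hy hij)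
    · intro v
      have hv : v ∈ Set.range x ∪ Set.range y := hcov ▸ Set.mem_univ v
      rcases hv with ⟨i, rfl⟩ | ⟨i, rfl⟩
      · exact ⟨Sum.inl i, rfl⟩
      · exact ⟨Sum.inr i, rfl⟩
  have hn : n = n₁ + n₂ := by
    simpa using (Fintype.card_of_bijective hbij).symm
  have hsum : n + ∑ v, G.degree v = ∑ v, (G.degree v + 1) := by
    rw [Finset.sum_add_distrib]
    simp [add_comm]
  have hge : n₁ * n₁ + n₂ * n₂ ≤ ∑ v, (G.degree v + 1) := by
    rw [← hbij.sum_comp fun v => G.degree v + 1, Fintype.sum_sum_type]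
    refine add_le_add ?_ ?_
    · exact le_trans (by simp) (Finset.card_nsmul_le_sum Finset.univ
        (fun i => G.degree (x i) + 1) n₁ fun i _ => hclique x hx hX i)
    · exact le_trans (by simp) (Finset.card_nsmul_le_sum Finset.univ
        (fun i => G.degree (y i) + 1) n₂ fun i _ => hclique y hy hY i)
  rw [hsum]
  refine le_trans ?_ (Nat.mul_le_mul_left 2 hge)
  rw [hn]
  -- Over the integers, `(n₁ + n₂)² ≤ 2 * (n₁² + n₂²)` is `(n₁ - n₂)² ≥ 0`.
  zify
  nlinarith [sq_nonneg ((n₁ : ℤ) - n₂)]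

end Combinatorics

/-! ### Reasoning about executions -/

namespace RAM

/-- Started in `s`, the program `p` halts within `T` steps in a state that satisfies `Q`, and every
number written on the way is at most `B`. -/
def Runs (B : ℕ) (p : Prog) (s : State) (T : ℕ) (Q : State → Prop) : Prop :=
  ∃ t s', Exec B p s t s' ∧ t ≤ T ∧ Q s'

namespace Runs

variable {B T T' : ℕ} {p q : Prog} {s : State} {Q R : State → Prop} {a b : Operand}

theorem skip (h : Q s) : Runs B .skip s 1 Q := ⟨1, s, .skip s, le_rfl, h⟩

theorem instr {i : Instr} (hB : i.result s ≤ B) (h : Q (i.next s)) : Runs B (.instr i) s 1 Q :=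
  ⟨1, _, .instr i s hB, le_rfl, h⟩

theorem seq (hp : Runs B p s T R) (hq : ∀ s', R s' → Runs B q s' T' Q) :
    Runs B (.seq p q) s (T + T') Q := by
  obtain ⟨t, s', he, ht, hR⟩ := hp
  obtain ⟨t', s'', he', ht', hQ⟩ := hq s' hR
  exact ⟨t + t', s'', .seq he he', add_le_add ht ht', hQ⟩

theorem instr_seq {i : Instr} (hB : i.result s ≤ B) (hq : Runs B q (i.next s) T Q) :
    Runs B (.seq (.instr i) q) s (1 + T) Q :=
  seq (R := fun s' => s' = i.next s) (instr hB rfl) (by rintro _ rfl; exact hq)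

theorem ite (hp : a.val s < b.val s → Runs B p s T Q) (hq : ¬ a.val s < b.val s → Runs B q s T Q) :
    Runs B (.ite a b p q) s (T + 1) Q := by
  by_cases h : a.val s < b.val s
  · obtain ⟨t, s', he, ht, hQ⟩ := hp h
    exact ⟨t + 1, s', .ite_true h he, by omega, hQ⟩
  · obtain ⟨t, s', he, ht, hQ⟩ := hq h
    exact ⟨t + 1, s', .ite_false h he, by omega, hQ⟩

/-- The invariant is indexed by completed iterations. Each iteration pays one step for its test, and
the final failing test gives the last `+ 1`. -/
theorem loop {N : ℕ} (I : ℕ → State → Prop)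
    (hstep : ∀ k s, k < N → I k s → a.val s < b.val s ∧ Runs B p s T (I (k + 1)))
    (hend : ∀ s, I N s → ¬ a.val s < b.val s) (h0 : I 0 s) :
    Runs B (.loop a b p) s (N * (T + 1) + 1) (I N) := by
  have key : ∀ d k s, k + d = N → I k s →
      Runs B (.loop a b p) s (d * (T + 1) + 1) (I N) := by
    intro d
    induction d with
    | zero =>
      intro k s hk hI
      obtain rfl : k = N := hk
      exact ⟨1, s, .loop_false (hend s hI), by omega, hI⟩
    | succ d ih =>
      intro k s hk hI
      obtain ⟨hlt, t, s', he, ht, hI'⟩ := hstep k s (by omega) hI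
      obtain ⟨t', s'', he', ht', hI''⟩ := ih (k + 1) s' (by omega) hI'
      refine ⟨t + t' + 1, s'', .loop_true hlt he he', ?_, hI''⟩
      rw [Nat.succ_mul]
      omega
  exact key N 0 s (Nat.zero_add N) h0

end Runs

/-! ### The program -/

/-- The position, relative to the first one, of the `v`-th block in a concatenation of blocks
that consist of the length and the entries of a list. -/
def offset {α : Type*} (L : List (List α)) (v : ℕ) : ℕ :=
  ((L.take v).map fun l => l.length + 1).sum

theorem offset_succ {α : Type*} (L : List (List α)) {v : ℕ} (hv : v < L.length) :
    offset L (v + 1) = offset L v + (L[v].length + 1) := by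
  simp only [offset]
  rw [List.take_add_one, List.getElem?_eq_getElem hv, List.map_append, List.sum_append]
  simp

/-- Skipping `v` blocks lands on a length entry, so degrees can be read without inspecting any
neighbour. -/
theorem getD_flatMap_offset {α : Type*} (f : α → ℕ) (L : List (List α)) {v : ℕ}
    (hv : v < L.length) :
    (L.flatMap fun l => l.length :: l.map f).getD (offset L v) 0 = L[v].length := by
  induction L generalizing v with
  | nil => simp at hv
  | cons l L ih =>
    cases v with
    | zero => simp [offset]
    | succ v =>
      have hoff : offset (l :: L) (v + 1) = (l.length :: l.map f).length + offset L v := by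
        simp [offset]
      rw [List.flatMap_cons, hoff, List.getD_append_right _ _ _ _ (Nat.le_add_right _ _),
        Nat.add_sub_cancel_left]
      simpa using ih (by simpa using hv)

theorem offset_le {α : Type*} (L : List (List α)) (v : ℕ) :
    offset L v ≤ (L.map fun l => l.length + 1).sum := by
  simp only [offset]
  exact ((List.take_sublist v L).map _).sum_le_sum (by simp)

/-- The body of the loop over the vertices: it skips to the next adjacency list and increments
register 5 if the length of the current list plus register 2 is below register 1. -/
def scanBody : Prog :=
  .seq (.instr (.add 4 (.reg 4) (.imm 1))) <|
  .seq (.instr (.load 6 (.reg 3))) <|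
  .seq (.instr (.add 3 (.reg 3) (.reg 6))) <|
  .seq (.instr (.add 3 (.reg 3) (.imm 1))) <|
  .seq (.instr (.add 6 (.reg 6) (.reg 2))) <|
  .ite (.reg 6) (.reg 1) (.instr (.add 5 (.reg 5) (.imm 1))) .skip

/-- The body of the outer loop: it increments register 2 to `s`, counts in register 5 the vertices
of degree less than `n - s` and increments register 0 if there are fewer than `2 * s` of them. -/
def countBody : Prog :=
  .seq (.instr (.add 2 (.reg 2) (.imm 1))) <|
  .seq (.instr (.mov 3 (.imm 1))) <|
  .seq (.instr (.mov 4 (.imm 0))) <|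
  .seq (.instr (.mov 5 (.imm 0))) <|
  .seq (.loop (.reg 4) (.reg 1) scanBody) <|
  .seq (.instr (.add 6 (.reg 2) (.reg 2))) <|
  .ite (.reg 5) (.reg 6) (.instr (.add 0 (.reg 0) (.imm 1))) .skip

/-- The program that computes the transitivity of complements of bipartite chain graphs. -/
def transitivityProg : Prog :=
  .seq (.instr (.load 1 (.imm 0))) <|
  .loop (.reg 2) (.reg 1) countBody

/-! ### Loop invariants, running time and word size. -/

section Correctness

variable {α : Type*} (f : α → ℕ) (L : List (List α))

/-- The memory that holds the lists `L`. -/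
def listMem (i : ℕ) : ℕ :=
  (L.length :: L.flatMap fun l => l.length :: l.map f).getD i 0

/-- The number of lists whose length plus `s` is less than the number of lists. -/
def shortCount (s v : ℕ) : ℕ := (L.take v).countP fun l => l.length + s < L.length

/-- The invariant of the loop over the vertices. -/
structure ScanInv (r s v : ℕ) (σ : State) : Prop where
  mem : σ.mem = listMem f L
  r0 : σ.reg 0 = r
  r1 : σ.reg 1 = L.length
  r2 : σ.reg 2 = s
  r3 : σ.reg 3 = 1 + offset L v
  r4 : σ.reg 4 = v
  r5 : σ.reg 5 = shortCount L s v

theorem listMem_offset {v : ℕ} (hv : v < L.length) :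
    listMem f L (1 + offset L v) = L[v].length := by
  rw [listMem, add_comm, List.getD_cons_succ, getD_flatMap_offset f L hv]

theorem shortCount_succ (s : ℕ) {v : ℕ} (hv : v < L.length) :
    shortCount L s (v + 1) = shortCount L s v + if L[v].length + s < L.length then 1 else 0 := by
  simp only [shortCount]
  rw [List.take_add_one, List.getElem?_eq_getElem hv, List.countP_append]
  simp [List.countP_cons]

theorem shortCount_le (s v : ℕ) : shortCount L s v ≤ v :=
  List.countP_le_length.trans (List.length_take_le _ _)

variable {f L}

theorem scanBody_runs {B r s v : ℕ} {σ : State}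
    (hB : (L.map fun l => l.length + 1).sum + L.length + 1 ≤ B) (hs : s ≤ L.length)
    (hv : v < L.length) (h : ScanInv f L r s v σ) :
    Runs B scanBody σ 7 (ScanInv f L r s (v + 1)) := by
  obtain ⟨hm, h0, h1, h2, h3, h4, h5⟩ := h
  have hmem : σ.mem (σ.reg 3) = L[v].length := by rw [hm, h3, listMem_offset f L hv]
  have hoff := offset_succ L hv
  have hle := offset_le L (v + 1)
  have hcnt := shortCount_succ L s hv
  have hcle := shortCount_le L s v
  refine Runs.instr_seq (T := 6) ?_ <| Runs.instr_seq (T := 5) ?_ <| Runs.instr_seq (T := 4) ?_ <|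
    Runs.instr_seq (T := 3) ?_ <| Runs.instr_seq (T := 2) ?_ <|
    Runs.ite (T := 1) (fun hlt => Runs.instr ?_ ?_) (fun hlt => Runs.skip ?_)
  · simp [Instr.result, Operand.val]; omega
  · simp [Instr.result, Instr.next, Operand.val]; omega
  · simp [Instr.result, Instr.next, Operand.val]; omega
  · simp [Instr.result, Instr.next, Operand.val]; omega
  · simp [Instr.result, Instr.next, Operand.val]; omega
  · simp [Instr.result, Instr.next, Operand.val]; omega
  · simp [Instr.result, Instr.next, Operand.val, hmem, h1, h2] at hlt
    constructor <;> simp [Instr.result, Instr.next, Operand.val, hm, h0, h1, h2, h4, h5]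
    · rw [← hm, hmem]; omega
    · rw [hcnt, if_pos hlt]
  · simp [Instr.result, Instr.next, Operand.val, hmem, h1, h2] at hlt
    constructor <;> simp [Instr.result, Instr.next, Operand.val, hm, h0, h1, h2, h4, h5]
    · rw [← hm, hmem]; omega
    · rw [hcnt, if_neg (by omega), add_zero]

/-- The number of `s ≤ k` that the program counts. -/
def smallCount (L : List (List α)) (k : ℕ) : ℕ :=
  ((Finset.range k).filter fun s => shortCount L (s + 1) L.length < 2 * (s + 1)).card

theorem smallCount_succ (k : ℕ) : smallCount L (k + 1) =
    smallCount L k + if shortCount L (k + 1) L.length < 2 * (k + 1) then 1 else 0 := by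
  simp only [smallCount, Finset.range_add_one, Finset.filter_insert]
  split_ifs
  · rw [Finset.card_insert_of_notMem (by simp)]
  · rfl

theorem smallCount_le (k : ℕ) : smallCount L k ≤ k :=
  (Finset.card_filter_le _ _).trans (by simp)

/-- The invariant of the outer loop. -/
structure CountInv (f : α → ℕ) (L : List (List α)) (k : ℕ) (σ : State) : Prop where
  mem : σ.mem = listMem f L
  r0 : σ.reg 0 = smallCount L k
  r1 : σ.reg 1 = L.length
  r2 : σ.reg 2 = k

theorem countBody_runs {B k : ℕ} {σ : State}
    (hB : (L.map fun l => l.length + 1).sum + L.length + 1 ≤ B) (hB' : 2 * L.length ≤ B)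
    (hk : k < L.length) (h : CountInv f L k σ) :
    Runs B countBody σ (8 * L.length + 8) (CountInv f L (k + 1)) := by
  obtain ⟨hm, h0, h1, h2⟩ := h
  have hsm := smallCount_le (L := L) k
  have hs := smallCount_succ (L := L) k
  -- Each pass of the inner loop costs 7 steps plus its test.
  have htime : 8 * L.length + 8 =
      1 + (1 + (1 + (1 + ((L.length * (7 + 1) + 1) + (1 + (1 + 1)))))) := by ring
  rw [htime]
  refine Runs.instr_seq ?_ <| Runs.instr_seq ?_ <| Runs.instr_seq ?_ <| Runs.instr_seq ?_ <|
    Runs.seq (Runs.loop (ScanInv f L (smallCount L k) (k + 1)) ?_ ?_ ?_) fun σ' h' =>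
    Runs.instr_seq ?_ <| Runs.ite (fun hlt => Runs.instr ?_ ?_) (fun hlt => Runs.skip ?_)
  · simp [Instr.result, Operand.val]; omega
  · simp [Instr.result, Operand.val]; omega
  · simp [Instr.result, Operand.val]
  · simp [Instr.result, Operand.val]
  · intro v σ hv hI
    refine ⟨?_, scanBody_runs hB hk hv hI⟩
    simpa [Operand.val, hI.r4, hI.r1] using hv
  · intro σ hI
    simp [Operand.val, hI.r4, hI.r1]
  · constructor <;>
      simp [Instr.result, Instr.next, Operand.val, hm, h0, h1, h2, offset, shortCount]
  · simp [Instr.result, Operand.val, h'.r2]; omega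
  · simp [Instr.result, Instr.next, Operand.val, h'.r0]; omega
  · simp [Instr.result, Instr.next, Operand.val, h'.r2, h'.r5] at hlt
    constructor <;> simp [Instr.result, Instr.next, Operand.val, h'.mem, h'.r0, h'.r1, h'.r2]
    rw [hs, if_pos (by omega)]
  · simp [Instr.result, Instr.next, Operand.val, h'.r2, h'.r5] at hlt
    constructor <;> simp [Instr.result, Instr.next, Operand.val, h'.mem, h'.r0, h'.r1, h'.r2]
    rw [hs, if_neg (by omega)]; rfl

/-- Registers start at `0`, so the output register 0 and the counter 2 need no initialization. -/
theorem transitivityProg_runs {B : ℕ}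
    (hB : (L.map fun l => l.length + 1).sum + L.length + 1 ≤ B) (hB' : 2 * L.length ≤ B) :
    Runs B transitivityProg
      (initState (L.length :: L.flatMap fun l => l.length :: l.map f))
      (1 + (L.length * (8 * L.length + 8 + 1) + 1))
      fun σ => σ.reg 0 = smallCount L L.length := by
  refine Runs.instr_seq ?_ ?_
  · simp [Instr.result, Operand.val, initState]; omega
  · obtain ⟨t, σ, he, ht, hI⟩ := Runs.loop (B := B) (a := .reg 2) (b := .reg 1) (p := countBody)
      (T := 8 * L.length + 8) (N := L.length)
      (s := (Instr.load 1 (.imm 0)).next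
        (initState (L.length :: L.flatMap fun l => l.length :: l.map f)))
      (CountInv f L) (fun k σ hk hI => ⟨by simpa [Operand.val, hI.r1, hI.r2] using hk,
        countBody_runs hB hB' hk hI⟩)
      (fun σ hI => by simp [Operand.val, hI.r1, hI.r2])
      (by
        constructor
        · funext i
          simp [Instr.next, initState, listMem]
        · simp [Instr.next, initState, smallCount]
        · simp [Instr.next, Instr.result, Operand.val, initState]
        · simp [Instr.next, initState])
    exact ⟨t, σ, he, ht, hI.r0⟩

end Correctness

end RAM

/-! ### From adjacency lists back to the graph. -/

theorem shortCount_ofFn {n : ℕ} (adj : Fin n → List (Fin n)) (s : ℕ) :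
    RAM.shortCount (List.ofFn adj) s (List.ofFn adj).length =
      (Finset.univ.filter fun v => (adj v).length + s < n).card := by
  rw [RAM.shortCount, List.take_length, List.length_ofFn, List.ofFn_eq_map, List.countP_map,
    List.countP_eq_length_filter, ← List.toFinset_card_of_nodup]
  · congr 1
    ext v
    simp
  · exact (List.nodup_finRange n).filter _

theorem encodeAdjacencyLists_eq {n : ℕ} (adj : Fin n → List (Fin n)) :
    encodeAdjacencyLists adj =
      n :: (List.ofFn adj).flatMap fun l => l.length :: l.map fun u : Fin n => (u : ℕ) := by
  -- The cast in `encodeAdjacencyLists` is a monadic lift of the whole list.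
  have h : ∀ l : List (Fin n), (l >>= fun a => pure (a : ℕ)) = l.map fun u : Fin n => (u : ℕ) :=
    fun l => List.flatMap_pure_eq_map _ l
  simp only [encodeAdjacencyLists, h, List.map_id']

theorem mainTheorem8 :
    ∃ (p : RAM.Prog) (c : ℕ), ∀ (n : ℕ) (G : SimpleGraph (Fin n)), IsBipartiteChain Gᶜ →
      ∀ adj : Fin n → List (Fin n), IsAdjacencyLists G adj →
        ∃ (t : ℕ) (s : RAM.State),
          RAM.Exec (c * (n + G.edgeSet.ncard + 1)) p
            (RAM.initState (encodeAdjacencyLists adj)) t s ∧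
          t ≤ c * (n + G.edgeSet.ncard + 1) ∧ s.reg 0 = transitivity G := by
  refine ⟨RAM.transitivityProg, 40, fun n G hG adj hadj => ?_⟩
  classical
  have hlen : ∀ v, (adj v).length = G.degree v := by
    intro v
    rw [← List.toFinset_card_of_nodup (hadj v).1, ← G.card_neighborFinset_eq_degree]
    congr 1
    ext u
    simp [(hadj v).2 u]
  have hdeg : ∑ v, G.degree v = 2 * G.edgeSet.ncard := by
    rw [G.sum_degrees_eq_twice_card_edges, ← SimpleGraph.coe_edgeFinset, Set.ncard_coe_finset]
  have hsq := sq_le_of_isBipartiteChain_compl G hG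
  rw [hdeg] at hsq
  have hsum : ((List.ofFn adj).map fun l => l.length + 1).sum = n + 2 * G.edgeSet.ncard := by
    rw [← hdeg, List.map_ofFn, List.sum_ofFn]
    simp [hlen, Finset.sum_add_distrib, add_comm]
  have hL : (List.ofFn adj).length = n := List.length_ofFn
  obtain ⟨t, s, he, ht, hs⟩ := RAM.transitivityProg_runs (f := fun u : Fin n => (u : ℕ))
    (L := List.ofFn adj) (B := 40 * (n + G.edgeSet.ncard + 1))
    (by rw [hsum, hL]; omega) (by rw [hL]; omega)
  refine ⟨t, s, ?_, ?_, ?_⟩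
  · rw [hL] at he
    rwa [encodeAdjacencyLists_eq]
  · rw [hL] at ht
    refine ht.trans ?_
    -- With `n² ≤ 2 * (n + 2 * m)`, the time `8 * n² + 9 * n + 2` is at most `25 * n + 32 * m + 2`,
    -- within the constant 40.
    nlinarith
  · rw [hs, transitivity_eq_card_filter G hG, RAM.smallCount, hL]
    have := shortCount_ofFn adj
    rw [hL] at this
    simp only [this, hlen]
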